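/- Let $(F,g_F)$ be a smooth Riemannian manifold without boundary of dimension $s\ge 2$, let $f\colon F\to(0,\infty)$ be smooth, let $I=(t_1,t_2)\subseteq\mathbb R$ be an open interval with $-\infty\le t_1<t_2\le\infty$, and let $M=I_f\times F$ be the standard static space-time, i.e. the manifold $I\times F$ with the Lorentzian metric $g=-f^2\,dt^2\oplus g_F$. Let $\mathrm{Ric}$ and $\mathrm{Ric}_F$ be the Ricci tensors of $(M,g)$ and $(F,g_F)$, let $H^f_F$ be the Hessian of $f$ with respect to $g_F$, let $\Delta_F f$ be its $g_F$-trace, and put $Q^f_F=\Delta_F f\,g_F-H^f_F$. A tangent vector $w$ of $M$ is time-like if $g(w,w)<0$, null if $w\neq0$ and $g(w,w)=0$, and causal if it is time-like or null. $M$ satisfies the time-like (respectively, null) convergence condition, TCC (respectively, NCC), if $\mathrm{Ric}(w,w)\ge0$ for all time-like (respectively, null) tangent vectors $w$ of $M$. 1. If the quadratic forms of $\mathrm{Ric}_F$ and $Q^f_F$ are positive semidefinite at every point of $F$, then $M$ satisfies the TCC and the NCC. 2. If the quadratic forms of $\mathrm{Ric}_F$ and $Q^f_F$ are negative semidefinite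 at every point of $F$, then $\mathrm{Ric}(w,w)\le0$ for every causal tangent vector $w$ of $M$. 3. If $(F,g_F)$ is Ricci flat (that is, $\mathrm{Ric}_F=0$), then the quadratic form of $Q^f_F$ is positive semidefinite at every point of $F$ if and only if $M$ satisfies the NCC. -/

import Mathlib

set_option maxSynthPendingDepth 3

open scoped Manifold ContDiff

noncomputable section

/-! ### Pseudo-Riemannian calculus on (an open subset of) a vector space

Here `G y` is the Gram form at `y` of a pseudo-Riemannian metric; everything is coordinate free,
with `D_u` the derivative in the constant direction `u`. -/

section Local

variable {E : Type*} [NormedAddCommGroup E] [NormedSpace ℝ E]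

/-- The Christoffel symbol of the first kind,
`Γ(u, v; w) = (D_u G (v, w) + D_v G (u, w) - D_w G (u, v)) / 2`. -/
def christoffelFirst (G : E → E →L[ℝ] E →L[ℝ] ℝ) (y : E) : E →L[ℝ] E →L[ℝ] E →L[ℝ] ℝ :=
  let D : E →L[ℝ] E →L[ℝ] E →L[ℝ] ℝ := fderiv ℝ G y
  let swap : (E →L[ℝ] E →L[ℝ] ℝ) →L[ℝ] (E →L[ℝ] E →L[ℝ] ℝ) :=
    (ContinuousLinearMap.flipₗᵢ ℝ E E ℝ).toContinuousLinearEquiv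
  (1 / 2 : ℝ) • (D + D.flip - swap ∘L D.flip)

lemma christoffelFirst_apply (G : E → E →L[ℝ] E →L[ℝ] ℝ) (y u v w : E) :
    christoffelFirst G y u v w =
      (1 / 2) * (fderiv ℝ G y u v w + fderiv ℝ G y v u w - fderiv ℝ G y w u v) := by
  simp [christoffelFirst]

/-- The Christoffel symbol `Γ(u, v)` of the Levi-Civita connection (that is, `∇_u v` for constant
vector fields `u`, `v`): the vector with `G (Γ(u, v), w) = Γ(u, v; w)` for all `w`. The inverse of
`G y : E → E*` is the usual raising of the index. -/
def christoffel (G : E → E →L[ℝ] E →L[ℝ] ℝ) (y : E) : E →L[ℝ] E →L[ℝ] E :=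
  (ContinuousLinearMap.compL ℝ E (E →L[ℝ] ℝ) E (G y).inverse) ∘L christoffelFirst G y

lemma christoffel_apply (G : E → E →L[ℝ] E →L[ℝ] ℝ) (y u v : E) :
    christoffel G y u v = (G y).inverse (christoffelFirst G y u v) := rfl

/-- The curvature tensor `R(u, v) w = ∇_u ∇_v w - ∇_v ∇_u w` for constant vector fields
`u`, `v`, `w`, whose brackets vanish. -/
def localCurvature (G : E → E →L[ℝ] E →L[ℝ] ℝ) (y u v w : E) : E :=
  fderiv ℝ (christoffel G) y u v w - fderiv ℝ (christoffel G) y v u w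
    + christoffel G y u (christoffel G y v w) - christoffel G y v (christoffel G y u w)

/-- The endomorphism `u ↦ R(u, v) w`. -/
def localCurvatureEnd (G : E → E →L[ℝ] E →L[ℝ] ℝ) (y v w : E) : E →ₗ[ℝ] E where
  toFun u := localCurvature G y u v w
  map_add' a b := by simp only [localCurvature, map_add, add_apply]; abel
  map_smul' c a := by
    simp only [localCurvature, map_smul, smul_apply, RingHom.id_apply, smul_sub, smul_add]

/-- The Ricci tensor `Ric(v, w) = trace (u ↦ R(u, v) w)`. -/
def localRicci (G : E → E →L[ℝ] E →L[ℝ] ℝ) (y v w : E) : ℝ :=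
  LinearMap.trace ℝ E (localCurvatureEnd G y v w)

/-- The Hessian `H(u, v) = D_u D_v h - D_{∇_u v} h` of a function `h`, for constant
vector fields `u`, `v`. -/
def localHessian (G : E → E →L[ℝ] E →L[ℝ] ℝ) (h : E → ℝ) (y : E) : E →L[ℝ] E →L[ℝ] ℝ :=
  fderiv ℝ (fderiv ℝ h) y - (ContinuousLinearMap.compL ℝ E E ℝ (fderiv ℝ h y)) ∘L christoffel G y

lemma localHessian_apply (G : E → E →L[ℝ] E →L[ℝ] ℝ) (h : E → ℝ) (y u v : E) :
    localHessian G h y u v = fderiv ℝ (fderiv ℝ h) y u v - fderiv ℝ h y (christoffel G y u v) :=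
  rfl

/-- The Laplacian: the trace with respect to `G` of the Hessian. -/
def localLaplacian (G : E → E →L[ℝ] E →L[ℝ] ℝ) (h : E → ℝ) (y : E) : ℝ :=
  LinearMap.trace ℝ E ((G y).inverse ∘L localHessian G h y : E →L[ℝ] E)

end Local

/-! ### Pseudo-Riemannian calculus on a manifold without boundary

A metric is given by its field `g` of bilinear forms on the tangent spaces. The notions below are
the standard ones whenever `g` is smooth, symmetric and nondegenerate, and the model has no
boundary. They are computed at a point `p` in the chart around `p` chosen by the charted space
structure, whose derivative at `p` is the identification `T_p M = E` used by Mathlib (so tangent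
vectors at `p` are their own coordinate vectors); being tensorial, they do not depend on the
chart. -/

section Mfd

variable {E : Type*} [NormedAddCommGroup E] [NormedSpace ℝ E]
  {H : Type*} [TopologicalSpace H] (I : ModelWithCorners ℝ E H)
  {M : Type*} [TopologicalSpace M] [ChartedSpace H M]

/-- The Gram form of `g` in the chart around `p`: the pull-back of `g` under the inverse chart. -/
def chartMetric (g : ∀ q : M, TangentSpace I q →L[ℝ] TangentSpace I q →L[ℝ] ℝ) (p : M) (y : E) :
    E →L[ℝ] E →L[ℝ] ℝ :=
  let A : E →L[ℝ] TangentSpace I ((extChartAt I p).symm y) :=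
    mfderiv 𝓘(ℝ, E) I (extChartAt I p).symm y
  (A.precomp ℝ) ∘L g ((extChartAt I p).symm y) ∘L A

/-- The Ricci tensor of the metric `g`. -/
def ricciTensor (g : ∀ q : M, TangentSpace I q →L[ℝ] TangentSpace I q →L[ℝ] ℝ) (p : M)
    (v w : TangentSpace I p) : ℝ :=
  localRicci (chartMetric I g p) (extChartAt I p p) v w

/-- The Hessian tensor of the function `h` with respect to the metric `g`. -/
def hessianTensor (g : ∀ q : M, TangentSpace I q →L[ℝ] TangentSpace I q →L[ℝ] ℝ) (h : M → ℝ)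
    (p : M) (v w : TangentSpace I p) : ℝ :=
  localHessian (chartMetric I g p) (h ∘ (extChartAt I p).symm) (extChartAt I p p) v w

/-- The Laplace-Beltrami operator (trace of the Hessian) of the metric `g`. -/
def laplaceBeltrami (g : ∀ q : M, TangentSpace I q →L[ℝ] TangentSpace I q →L[ℝ] ℝ) (h : M → ℝ)
    (p : M) : ℝ :=
  localLaplacian (chartMetric I g p) (h ∘ (extChartAt I p).symm) (extChartAt I p p)

/-- The tensor `Q^h = (Δ h) g - H^h`. -/
def qTensor (g : ∀ q : M, TangentSpace I q →L[ℝ] TangentSpace I q →L[ℝ] ℝ) (h : M → ℝ)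
    (p : M) (v w : TangentSpace I p) : ℝ :=
  laplaceBeltrami I g h p * g p v w - hessianTensor I g h p v w

/-- The quadratic form of a `2`-covariant tensor field is positive semidefinite everywhere. -/
def TensorPosSemidef (T : ∀ p : M, TangentSpace I p → TangentSpace I p → ℝ) : Prop :=
  ∀ (p : M) (v : TangentSpace I p), 0 ≤ T p v v

/-- The quadratic form of a `2`-covariant tensor field is negative semidefinite everywhere. -/
def TensorNegSemidef (T : ∀ p : M, TangentSpace I p → TangentSpace I p → ℝ) : Prop :=
  ∀ (p : M) (v : TangentSpace I p), T p v v ≤ 0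

/-- The metric `g` is Ricci flat. -/
def RicciFlat (g : ∀ q : M, TangentSpace I q →L[ℝ] TangentSpace I q →L[ℝ] ℝ) : Prop :=
  ∀ (p : M) (v w : TangentSpace I p), ricciTensor I g p v w = 0

variable {I} in
/-- Time-like tangent vectors. -/
def IsTimelike (g : ∀ q : M, TangentSpace I q →L[ℝ] TangentSpace I q →L[ℝ] ℝ) {p : M}
    (w : TangentSpace I p) : Prop :=
  g p w w < 0

variable {I} in
/-- Null tangent vectors (nonzero by convention). -/
def IsNull (g : ∀ q : M, TangentSpace I q →L[ℝ] TangentSpace I q →L[ℝ] ℝ) {p : M}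
    (w : TangentSpace I p) : Prop :=
  w ≠ 0 ∧ g p w w = 0

variable {I} in
/-- Causal tangent vectors: those that are time-like or null. -/
def IsCausal (g : ∀ q : M, TangentSpace I q →L[ℝ] TangentSpace I q →L[ℝ] ℝ) {p : M}
    (w : TangentSpace I p) : Prop :=
  IsTimelike g w ∨ IsNull g w

/-- The time-like convergence condition. -/
def SatisfiesTCC (g : ∀ q : M, TangentSpace I q →L[ℝ] TangentSpace I q →L[ℝ] ℝ) : Prop :=
  ∀ (p : M) (w : TangentSpace I p), IsTimelike g w → 0 ≤ ricciTensor I g p w w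

/-- The null convergence condition. -/
def SatisfiesNCC (g : ∀ q : M, TangentSpace I q →L[ℝ] TangentSpace I q →L[ℝ] ℝ) : Prop :=
  ∀ (p : M) (w : TangentSpace I p), IsNull g w → 0 ≤ ricciTensor I g p w w

end Mfd

/-! ### Standard static space-times -/

/-- The open interval `(t₁, t₂)` of real numbers, with possibly infinite end points, as an open
submanifold of `ℝ`. -/
def openInterval (t₁ t₂ : EReal) : TopologicalSpace.Opens ℝ :=
  ⟨{t : ℝ | t₁ < (t : EReal) ∧ (t : EReal) < t₂},
    (isOpen_lt continuous_const continuous_coe_real_ereal).inter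
      (isOpen_lt continuous_coe_real_ereal continuous_const)⟩

/-- The metric `-f² dt² ⊕ g_F` on `(t₁, t₂) × F`, where `dt` is the differential of the coordinate
function `t` and `g_F` is pulled back along the projection to `F`. -/
def standardStaticMetric {s : ℕ} {F : Type*} [TopologicalSpace F]
    [ChartedSpace (EuclideanSpace ℝ (Fin s)) F] (t₁ t₂ : EReal)
    (gF : ∀ x : F, TangentSpace (𝓡 s) x →L[ℝ] TangentSpace (𝓡 s) x →L[ℝ] ℝ) (f : F → ℝ)
    (p : openInterval t₁ t₂ × F) :
    TangentSpace (𝓘(ℝ, ℝ).prod (𝓡 s)) p →L[ℝ] TangentSpace (𝓘(ℝ, ℝ).prod (𝓡 s)) p →L[ℝ] ℝ :=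
  let dt : TangentSpace (𝓘(ℝ, ℝ).prod (𝓡 s)) p →L[ℝ] ℝ :=
    mfderiv (𝓘(ℝ, ℝ).prod (𝓡 s)) 𝓘(ℝ, ℝ)
      (fun q : openInterval t₁ t₂ × F => (q.1 : ℝ)) p
  let dσ : TangentSpace (𝓘(ℝ, ℝ).prod (𝓡 s)) p →L[ℝ] TangentSpace (𝓡 s) p.2 :=
    mfderiv (𝓘(ℝ, ℝ).prod (𝓡 s)) (𝓡 s) (fun q : openInterval t₁ t₂ × F => q.2) p
  (dσ.precomp ℝ) ∘L gF p.2 ∘L dσ - (f p.2) ^ 2 • dt.smulRight dt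

end

/-! For `w = (τ, v)` at a point over `x`, the product structure gives `Ric(w, w) = Ric_F(v, v) -
H(v, v) / f + τ² f Δf`. Substituting `H = Δf g_F - Q` and `f² τ² = g_F(v, v) - g(w, w)` turns this
into `Ric(w, w) = Ric_F(v, v) + Q(v, v) / f - g(w, w) Δf / f`
(`ricciTensor_standardStaticMetric_eq`). On causal vectors `-g(w, w) ≥ 0`, and the trace of `Q` is
`(s - 1) Δf`, so for `s ≥ 2` a semidefinite `Q` forces its sign on `Δf` (`laplaceBeltrami_nonneg`).
All three terms then have one sign. Conversely, in the Ricci flat case every `v ≠ 0` lifts to a null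
vector, for which only `Q(v, v) / f` survives. The first formula is a coordinate computation
(`localRicci_staticGram`), carried to the manifold by `chartMetric_standardStaticMetric`. -/

open scoped Topology

/-! ### Traces, invertible bilinear forms, regularity of Christoffel symbols. -/

section LocalLemmas

variable {V : Type*} [NormedAddCommGroup V] [NormedSpace ℝ V]

lemma LinearMap.trace_real_prod [FiniteDimensional ℝ V] (T : (ℝ × V) →ₗ[ℝ] (ℝ × V)) :
    LinearMap.trace ℝ (ℝ × V) T =
      (T (1, 0)).1 + LinearMap.trace ℝ V (LinearMap.snd ℝ ℝ V ∘ₗ T ∘ₗ LinearMap.inr ℝ ℝ V) := by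
  have hT : T = LinearMap.inl ℝ ℝ V ∘ₗ (LinearMap.fst ℝ ℝ V ∘ₗ T) +
      LinearMap.inr ℝ ℝ V ∘ₗ (LinearMap.snd ℝ ℝ V ∘ₗ T) := by
    ext <;> simp
  conv_lhs => rw [hT, map_add, LinearMap.trace_comp_comm', 
    LinearMap.trace_comp_comm' (LinearMap.snd ℝ ℝ V ∘ₗ T) (LinearMap.inr ℝ ℝ V)]
  congr 1
  rw [LinearMap.trace_eq_matrix_trace ℝ (Module.Basis.singleton Unit ℝ)]
  simp [Matrix.trace, LinearMap.toMatrix_apply]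

/-- `ContinuousLinearMap.inverse` is zero on non-invertible maps, so raising an index is meaningful
only once this is known. -/
lemma isInvertible_of_nondegenerate [FiniteDimensional ℝ V] {B : V →L[ℝ] V →L[ℝ] ℝ}
    (hB : ∀ v, (∀ w, B v w = 0) → v = 0) : B.IsInvertible := by
  have hinj : Function.Injective (B : V →ₗ[ℝ] V →L[ℝ] ℝ) := by
    rw [← LinearMap.ker_eq_bot, LinearMap.ker_eq_bot']
    intro v hv
    have hv' : B v = 0 := hv
    exact hB v fun w => by simp [hv']
  have hdim : Module.finrank ℝ V = Module.finrank ℝ (V →L[ℝ] ℝ) := by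
    rw [← (LinearMap.toContinuousLinearMap (𝕜 := ℝ) (E := V) (F' := ℝ)).finrank_eq]
    exact (Subspace.dual_finrank_eq (K := ℝ) (V := V)).symm
  let e := LinearEquiv.ofInjectiveOfFinrankEq (B : V →ₗ[ℝ] V →L[ℝ] ℝ) hinj hdim
  exact ⟨e.toContinuousLinearEquiv, by ext; rfl⟩

lemma isInvertible_of_pos [FiniteDimensional ℝ V] {B : V →L[ℝ] V →L[ℝ] ℝ}
    (hpos : ∀ v, v ≠ 0 → 0 < B v v) : B.IsInvertible :=
  isInvertible_of_nondegenerate fun v hv => by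
    by_contra hne
    exact (hpos v hne).ne' (hv v)

/-- The metric trace of a bilinear form with nonnegative quadratic form is nonnegative. -/
lemma trace_inverse_comp_nonneg [FiniteDimensional ℝ V] {G B : V →L[ℝ] V →L[ℝ] ℝ}
    (hsymm : ∀ v w, G v w = G w v) (hpos : ∀ v, v ≠ 0 → 0 < G v v) (hB : ∀ v, 0 ≤ B v v) :
    0 ≤ LinearMap.trace ℝ V (G.inverse ∘L B : V →L[ℝ] V) := by
  let Gb : LinearMap.BilinForm ℝ V :=
    LinearMap.mk₂ ℝ (fun v w => G v w) (by simp) (by simp) (by simp) (by simp)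
  obtain ⟨b, hb⟩ := LinearMap.BilinForm.exists_orthogonal_basis (B := Gb)
    ⟨fun v w => hsymm v w⟩
  -- Coordinates in a `G`-orthogonal basis are `G x (b i) / G (b i) (b i)`, so the diagonal entries
  -- of the endomorphism are `B (b i) (b i) / G (b i) (b i)`.
  have key : ∀ x i, G x (b i) = b.repr x i * G (b i) (b i) := by
    intro x i
    conv_lhs => rw [← b.sum_repr x]
    rw [map_sum, sum_apply, Finset.sum_eq_single i]
    · simp
    · intro j _ hj
      have : G (b j) (b i) = 0 := hb hj
      simp [this]
    · simp
  rw [LinearMap.trace_eq_matrix_trace ℝ b, Matrix.trace]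
  refine Finset.sum_nonneg fun i _ => ?_
  have hi := hpos (b i) (b.ne_zero i)
  have h1 := key (G.inverse (B (b i))) i
  rw [(isInvertible_of_pos hpos).self_apply_inverse] at h1
  rw [Matrix.diag_apply, LinearMap.toMatrix_apply]
  have h2 := hB (b i)
  rw [h1] at h2
  exact nonneg_of_mul_nonneg_left h2 hi

lemma differentiableAt_christoffel [CompleteSpace V] {G : V → V →L[ℝ] V →L[ℝ] ℝ} {y : V}
    (hG : ContDiffAt ℝ 2 G y) (hinv : (G y).IsInvertible) :
    DifferentiableAt ℝ (christoffel G) y := by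
  have h1 : DifferentiableAt ℝ (fderiv ℝ G) y :=
    (hG.fderiv_right (m := 1) (by norm_num)).differentiableAt (by norm_num)
  have h2 : DifferentiableAt ℝ (fun x => (G x).inverse) y :=
    ((hinv.contDiffAt_map_inverse (n := 1)).differentiableAt (by norm_num)).comp y
      (hG.differentiableAt (by norm_num))
  have h4 : DifferentiableAt ℝ (christoffelFirst G) y := by
    have hflip : DifferentiableAt ℝ (fun x => (fderiv ℝ G x).flip) y :=
      (ContinuousLinearMap.flipₗᵢ ℝ V V (V →L[ℝ] ℝ)).toContinuousLinearEquiv.differentiableAt.comp y h1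
    unfold christoffelFirst
    exact DifferentiableAt.const_smul
      ((h1.add hflip).sub ((differentiableAt_const _).clm_comp hflip)) (1 / 2 : ℝ)
  unfold christoffel
  exact (((ContinuousLinearMap.compL ℝ V (V →L[ℝ] ℝ) V).differentiableAt).comp y h2).clm_comp h4

end LocalLemmas

/-! ### Curvature of the static metric in coordinates. -/

section StaticGram

variable {V : Type*} [NormedAddCommGroup V] [NormedSpace ℝ V]

/-- The Gram form of the warped product metric `-h² dt² ⊕ G` on `ℝ × V`. -/
noncomputable def staticGram (G : V → V →L[ℝ] V →L[ℝ] ℝ) (h : V → ℝ) (y : ℝ × V) :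
    (ℝ × V) →L[ℝ] (ℝ × V) →L[ℝ] ℝ :=
  ((ContinuousLinearMap.snd ℝ ℝ V).precomp ℝ) ∘L G y.2 ∘L ContinuousLinearMap.snd ℝ ℝ V -
    (h y.2) ^ 2 • (ContinuousLinearMap.fst ℝ ℝ V).smulRight (ContinuousLinearMap.fst ℝ ℝ V)

lemma staticGram_apply (G : V → V →L[ℝ] V →L[ℝ] ℝ) (h : V → ℝ) (y X Y : ℝ × V) :
    staticGram G h y X Y = G y.2 X.2 Y.2 - (h y.2) ^ 2 * (X.1 * Y.1) := by
  simp [staticGram]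

lemma contDiffAt_staticGram {G : V → V →L[ℝ] V →L[ℝ] ℝ} {h : V → ℝ} {n : ℕ∞ω} {y : ℝ × V}
    (hG : ContDiffAt ℝ n G y.2) (hh : ContDiffAt ℝ n h y.2) :
    ContDiffAt ℝ n (staticGram G h) y := by
  have hG' : ContDiffAt ℝ n (fun y : ℝ × V => G y.2) y := hG.comp y contDiffAt_snd
  have hh' : ContDiffAt ℝ n (fun y : ℝ × V => h y.2) y := hh.comp y contDiffAt_snd
  unfold staticGram
  exact (contDiffAt_const.clm_comp (hG'.clm_comp contDiffAt_const)).sub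
    ((hh'.pow 2).smul contDiffAt_const)

lemma fderiv_staticGram_apply {G : V → V →L[ℝ] V →L[ℝ] ℝ} {h : V → ℝ} {y : ℝ × V}
    (hG : DifferentiableAt ℝ G y.2) (hh : DifferentiableAt ℝ h y.2) (X Y Z : ℝ × V) :
    fderiv ℝ (staticGram G h) y X Y Z =
      fderiv ℝ G y.2 X.2 Y.2 Z.2 - 2 * h y.2 * fderiv ℝ h y.2 X.2 * (Y.1 * Z.1) := by
  have hsnd : HasFDerivAt (Prod.snd : ℝ × V → V) (ContinuousLinearMap.snd ℝ ℝ V) y :=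
    hasFDerivAt_snd
  have hG' := hG.hasFDerivAt.comp y hsnd
  have hh' := (hh.hasFDerivAt.comp y hsnd).pow 2
  have hGYZ := (((hG'.clm_apply (hasFDerivAt_const Y.2 y))).clm_apply (hasFDerivAt_const Z.2 y))
  -- With `Y` and `Z` frozen, only a scalar function has to be differentiated; uniqueness of
  -- derivatives does the rest.
  have hYZ := hGYZ.sub (hh'.mul_const (Y.1 * Z.1))
  have hd : DifferentiableAt ℝ (staticGram G h) y := by
    have hG'' := hG'.differentiableAt
    have hh'' := hh'.differentiableAt
    unfold staticGram
    exact ((differentiableAt_const _).clm_comp (hG''.clm_comp (differentiableAt_const _))).sub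
      (hh''.smul (differentiableAt_const _))
  have hev := ((hd.hasFDerivAt.clm_apply (hasFDerivAt_const Y y))).clm_apply
    (hasFDerivAt_const Z y)
  have heq := congrArg (fun A : (ℝ × V) →L[ℝ] ℝ => A X) (hev.unique (hYZ.congr_of_eventuallyEq
    (Filter.Eventually.of_forall fun z => staticGram_apply G h z Y Z)))
  simp at heq
  rw [heq]
  ring

lemma isInvertible_staticGram [FiniteDimensional ℝ V] {G : V → V →L[ℝ] V →L[ℝ] ℝ} {h : V → ℝ}
    {y : ℝ × V} (hpos : ∀ v, v ≠ 0 → 0 < G y.2 v v) (hh : h y.2 ≠ 0) :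
    (staticGram G h y).IsInvertible := by
  refine isInvertible_of_nondegenerate fun X hX => ?_
  have h1 := hX (1, 0)
  have h2 := hX (0, X.2)
  simp only [staticGram_apply, map_zero, zero_sub, mul_one, mul_zero, sub_zero, neg_eq_zero] at h1 h2
  refine Prod.ext ?_ ?_
  · exact (mul_eq_zero.1 h1).resolve_left (pow_ne_zero 2 hh)
  · by_contra hne
    exact (hpos _ hne).ne' h2

/-- The gradient of `h` with respect to `G`. -/
noncomputable def localGradient (G : V → V →L[ℝ] V →L[ℝ] ℝ) (h : V → ℝ) (y : V) : V :=
  (G y).inverse (fderiv ℝ h y)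

/-- Nothing depends on time, so besides the symbols of `G` only derivatives of `h²` enter. After
lowering the index, both components can be read off from the Koszul formula. -/
lemma christoffel_staticGram [FiniteDimensional ℝ V] {G : V → V →L[ℝ] V →L[ℝ] ℝ} {h : V → ℝ}
    {y : ℝ × V} (hG : DifferentiableAt ℝ G y.2) (hh : DifferentiableAt ℝ h y.2)
    (hpos : ∀ v, v ≠ 0 → 0 < G y.2 v v) (hne : h y.2 ≠ 0) (X Y : ℝ × V) :
    christoffel (staticGram G h) y X Y =
      ((h y.2)⁻¹ * (Y.1 * fderiv ℝ h y.2 X.2 + X.1 * fderiv ℝ h y.2 Y.2),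
        christoffel G y.2 X.2 Y.2 + (X.1 * Y.1 * h y.2) • localGradient G h y.2) := by
  have hGi := isInvertible_of_pos hpos
  rw [christoffel_apply, (isInvertible_staticGram hpos hne).inverse_apply_eq]
  ext Z
  · simp [staticGram_apply, christoffelFirst_apply, fderiv_staticGram_apply hG hh]
    field_simp
    ring
  · simp [staticGram_apply, christoffelFirst_apply, fderiv_staticGram_apply hG hh,
      christoffel_apply, localGradient, hGi.self_apply_inverse]
    ring

lemma differentiableAt_localGradient [CompleteSpace V] {G : V → V →L[ℝ] V →L[ℝ] ℝ}
    {h : V → ℝ} {x : V} (hG : DifferentiableAt ℝ G x) (hh : ContDiffAt ℝ 2 h x)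
    (hinv : (G x).IsInvertible) : DifferentiableAt ℝ (localGradient G h) x := by
  have h1 : DifferentiableAt ℝ (fderiv ℝ h) x :=
    (hh.fderiv_right (m := 1) (by norm_num)).differentiableAt (by norm_num)
  have h2 : DifferentiableAt ℝ (fun z => (G z).inverse) x :=
    ((hinv.contDiffAt_map_inverse (n := 1)).differentiableAt (by norm_num)).comp x hG
  exact h2.clm_apply h1

/-- The covariant derivative of the gradient is the Hessian with an index raised. -/
lemma fderiv_localGradient_add_christoffel [CompleteSpace V] {G : V → V →L[ℝ] V →L[ℝ] ℝ}
    {h : V → ℝ} {x : V} (hG : DifferentiableAt ℝ G x) (hh : ContDiffAt ℝ 2 h x)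
    (hsymm : ∀ᶠ z in 𝓝 x, ∀ v w, G z v w = G z w v) (hinv : ∀ᶠ z in 𝓝 x, (G z).IsInvertible)
    (w : V) :
    fderiv ℝ (localGradient G h) x w + christoffel G x w (localGradient G h x) =
      (G x).inverse (localHessian G h x w) := by
  have hGi := hinv.self_of_nhds
  have h1 : DifferentiableAt ℝ (fderiv ℝ h) x :=
    (hh.fderiv_right (m := 1) (by norm_num)).differentiableAt (by norm_num)
  have hlower : ∀ z, (G z).IsInvertible → G z (localGradient G h z) = fderiv ℝ h z :=
    fun z hz => hz.self_apply_inverse _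
  have hgrad := (differentiableAt_localGradient hG hh hGi).hasFDerivAt
  have hsymm' : ∀ u v z, fderiv ℝ G x u v z = fderiv ℝ G x u z v := by
    intro u v z
    have hvz := ((hG.hasFDerivAt.clm_apply (hasFDerivAt_const v x))).clm_apply
      (hasFDerivAt_const z x)
    have hzv := ((hG.hasFDerivAt.clm_apply (hasFDerivAt_const z x))).clm_apply
      (hasFDerivAt_const v x)
    have := congrArg (fun A : V →L[ℝ] ℝ => A u)
      (hvz.unique (hzv.congr_of_eventuallyEq (hsymm.mono fun y hy => hy v z)))
    simpa using this
  -- Differentiate the identity `G (grad h) = dh`, valid near `x`; the derivative of `G` is then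
  -- absorbed by the Christoffel terms.
  have hleib : fderiv ℝ G x w (localGradient G h x) + G x (fderiv ℝ (localGradient G h) x w) =
      fderiv ℝ (fderiv ℝ h) x w := by
    have := congrArg (fun A : V →L[ℝ] V →L[ℝ] ℝ => A w)
      ((hG.hasFDerivAt.clm_apply hgrad).unique
        (h1.hasFDerivAt.congr_of_eventuallyEq (hinv.mono hlower)))
    simp at this
    rw [← this, add_comm]
  apply hGi.injective
  rw [map_add, hGi.self_apply_inverse, christoffel_apply, hGi.self_apply_inverse]
  ext v
  have hv := congrArg (fun A : V →L[ℝ] ℝ => A v) hleib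
  simp only [add_apply] at hv
  rw [add_apply, localHessian_apply, ← hv, ← hlower x hGi, hsymm.self_of_nhds,
    christoffel_apply, hsymm.self_of_nhds (localGradient G h x), hGi.self_apply_inverse,
    christoffelFirst_apply, christoffelFirst_apply,
    hsymm.self_of_nhds v, hsymm' w v, hsymm' v w]
  ring

lemma localCurvature_eq_fderiv {G : V → V →L[ℝ] V →L[ℝ] ℝ} {y : V}
    (hd : DifferentiableAt ℝ (christoffel G) y) (u v w : V) :
    localCurvature G y u v w =
      fderiv ℝ (fun z => christoffel G z v w) y u - fderiv ℝ (fun z => christoffel G z u w) y v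
        + christoffel G y u (christoffel G y v w) - christoffel G y v (christoffel G y u w) := by
  have key : ∀ a b c, fderiv ℝ (fun z => christoffel G z b c) y a =
      fderiv ℝ (christoffel G) y a b c := by
    intro a b c
    rw [((hd.hasFDerivAt.clm_apply (hasFDerivAt_const b y)).clm_apply
      (hasFDerivAt_const c y)).fderiv]
    simp
  rw [key, key, localCurvature]

/-- Ricci involves only derivatives of the metric at the point, so a formula for the Gram form near
the point suffices. -/
lemma Filter.EventuallyEq.localRicci_eq {G G' : V → V →L[ℝ] V →L[ℝ] ℝ} {y : V}
    (hG : G =ᶠ[𝓝 y] G') : localRicci G y = localRicci G' y := by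
  have hΓ : christoffel G =ᶠ[𝓝 y] christoffel G' := by
    filter_upwards [hG, hG.fderiv (𝕜 := ℝ)] with z hz hz'
    simp only [christoffel, christoffelFirst, hz, hz']
  have hR : localCurvature G y = localCurvature G' y := by
    ext u v w
    simp only [localCurvature, hΓ.fderiv_eq, hΓ.self_of_nhds]
  ext v w
  simp only [localRicci, localCurvatureEnd, hR]

/-- The Ricci curvature of the warped product metric `-h² dt² ⊕ G`. -/
lemma localRicci_staticGram [FiniteDimensional ℝ V] {G : V → V →L[ℝ] V →L[ℝ] ℝ} {h : V → ℝ}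
    {y : ℝ × V} (hG : ContDiffAt ℝ 2 G y.2) (hh : ContDiffAt ℝ 2 h y.2)
    (hsymm : ∀ᶠ z in 𝓝 y.2, ∀ v w, G z v w = G z w v)
    (hpos : ∀ᶠ z in 𝓝 y.2, ∀ v, v ≠ 0 → 0 < G z v v) (hne : h y.2 ≠ 0) (X : ℝ × V) :
    localRicci (staticGram G h) y X X =
      localRicci G y.2 X.2 X.2 - (h y.2)⁻¹ * localHessian G h y.2 X.2 X.2 +
        X.1 ^ 2 * h y.2 * localLaplacian G h y.2 := by
  have hcomplete : CompleteSpace V := FiniteDimensional.complete ℝ V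
  have hsnd : HasFDerivAt (Prod.snd : ℝ × V → V) (ContinuousLinearMap.snd ℝ ℝ V) y :=
    hasFDerivAt_snd
  have hposy := hpos.self_of_nhds
  have hGd : DifferentiableAt ℝ G y.2 := hG.differentiableAt (by norm_num)
  have hhd : DifferentiableAt ℝ h y.2 := hh.differentiableAt (by norm_num)
  have hh1 : DifferentiableAt ℝ (fderiv ℝ h) y.2 :=
    (hh.fderiv_right (m := 1) (by norm_num)).differentiableAt (by norm_num)
  have hΓ := differentiableAt_christoffel hG (isInvertible_of_pos hposy)
  have hS := differentiableAt_christoffel (contDiffAt_staticGram hG hh)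
    (isInvertible_staticGram hposy hne)
  have hgrad := differentiableAt_localGradient hGd hh (isInvertible_of_pos hposy)
  -- The formula for the symbols is needed on a neighbourhood, since it is differentiated next.
  have hev : ∀ Y Z : ℝ × V, (fun z => christoffel (staticGram G h) z Y Z) =ᶠ[𝓝 y] fun z =>
      ((h z.2)⁻¹ * (Z.1 * fderiv ℝ h z.2 Y.2 + Y.1 * fderiv ℝ h z.2 Z.2),
        christoffel G z.2 Y.2 Z.2 + (Y.1 * Z.1 * h z.2) • localGradient G h z.2) := by
    intro Y Z
    have e1 := (hG.eventually (by simp)).and ((hh.eventually (by simp)).and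
      (hpos.and (hhd.continuousAt.eventually_ne hne)))
    filter_upwards [(continuous_snd.tendsto y).eventually e1] with z hz
    exact christoffel_staticGram (hz.1.differentiableAt (by norm_num))
      (hz.2.1.differentiableAt (by norm_num)) hz.2.2.1 hz.2.2.2 Y Z
  have hderiv : ∀ Y Z W : ℝ × V, fderiv ℝ (fun z => christoffel (staticGram G h) z Y Z) y W =
      (-((h y.2) ^ 2)⁻¹ * fderiv ℝ h y.2 W.2 * (Z.1 * fderiv ℝ h y.2 Y.2 + Y.1 * fderiv ℝ h y.2 Z.2)
        + (h y.2)⁻¹ * (Z.1 * fderiv ℝ (fderiv ℝ h) y.2 W.2 Y.2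
          + Y.1 * fderiv ℝ (fderiv ℝ h) y.2 W.2 Z.2),
        fderiv ℝ (christoffel G) y.2 W.2 Y.2 Z.2
          + (Y.1 * Z.1 * fderiv ℝ h y.2 W.2) • localGradient G h y.2
          + (Y.1 * Z.1 * h y.2) • fderiv ℝ (localGradient G h) y.2 W.2) := by
    intro Y Z W
    have hh' := hhd.hasFDerivAt.comp y hsnd
    have hinv' := (hasDerivAt_inv hne).comp_hasFDerivAt y hh'
    have hdh := fun v : V => (hh1.hasFDerivAt.comp y hsnd).clm_apply (hasFDerivAt_const v y)
    have hΓ' := ((hΓ.hasFDerivAt.comp y hsnd).clm_apply (hasFDerivAt_const Y.2 y)).clm_apply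
      (hasFDerivAt_const Z.2 y)
    have hgrad' := hgrad.hasFDerivAt.comp y hsnd
    have h1 := hinv'.mul (((hdh Y.2).const_mul Z.1).add ((hdh Z.2).const_mul Y.1))
    have h2 := hΓ'.add ((hh'.const_mul (Y.1 * Z.1)).smul hgrad')
    have := ((h1.prodMk h2).congr_of_eventuallyEq (hev Y Z)).fderiv
    rw [this]
    ext
    · simp
      ring
    · simp
      module
  have hval : ∀ Y Z : ℝ × V, christoffel (staticGram G h) y Y Z = _ := fun Y Z =>
    christoffel_staticGram hGd hhd hposy hne Y Z
  have hcurv : ∀ Y, localCurvature (staticGram G h) y Y X X = _ := fun Y =>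
    localCurvature_eq_fderiv hS Y X X
  simp only [hderiv, hval] at hcurv
  rw [localRicci, LinearMap.trace_real_prod, localRicci, localLaplacian]
  -- The time-time entry of the trace: all terms involving `X.1` cancel, leaving the Hessian.
  have htime : (localCurvatureEnd (staticGram G h) y X X (1, 0)).1 =
      -((h y.2)⁻¹ * localHessian G h y.2 X.2 X.2) := by
    change (localCurvature (staticGram G h) y (1, 0) X X).1 = _
    rw [hcurv, localHessian_apply]
    simp
    field_simp
    ring
  -- The spatial block: the curvature of `G` plus the covariant derivative of `grad h`, that is, the
  -- Hessian with an index raised, whose trace is the Laplacian.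
  have hspace : LinearMap.snd ℝ ℝ V ∘ₗ localCurvatureEnd (staticGram G h) y X X ∘ₗ
      LinearMap.inr ℝ ℝ V = localCurvatureEnd G y.2 X.2 X.2 + (X.1 ^ 2 * h y.2) •
        ((G y.2).inverse ∘L localHessian G h y.2 : V →L[ℝ] V) := by
    ext w
    change (localCurvature (staticGram G h) y (0, w) X X).2 =
      localCurvature G y.2 w X.2 X.2 + (X.1 ^ 2 * h y.2) •
        (G y.2).inverse (localHessian G h y.2 w)
    rw [hcurv, ← fderiv_localGradient_add_christoffel hGd hh hsymm
      (hpos.mono fun z hz => isInvertible_of_pos hz), localCurvature]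
    simp
    match_scalars <;> field_simp
    ring
  rw [htime, hspace, map_add, map_smul, smul_eq_mul]
  ring

end StaticGram

/-! ### Gram forms in charts. -/

section ChartMetric

open Bundle

variable {E : Type*} [NormedAddCommGroup E] [NormedSpace ℝ E]
  {H : Type*} [TopologicalSpace H] {I : ModelWithCorners ℝ E H}
  {M : Type*} [TopologicalSpace M] [ChartedSpace H M]

lemma chartMetric_apply (g : ∀ q : M, TangentSpace I q →L[ℝ] TangentSpace I q →L[ℝ] ℝ) (p : M)
    (y u v : E) : chartMetric I g p y u v =
      g ((extChartAt I p).symm y) (mfderiv 𝓘(ℝ, E) I (extChartAt I p).symm y u)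
        (mfderiv 𝓘(ℝ, E) I (extChartAt I p).symm y v) := rfl

variable [I.Boundaryless]

lemma mfderiv_extChartAt_symm_self [IsManifold I 1 M] (p : M) (v : E) :
    (mfderiv 𝓘(ℝ, E) I (extChartAt I p).symm (extChartAt I p p) v : E) = v := by
  have h := mfderivWithin_range_extChartAt_symm (I := I) (x := p)
  rw [I.range_eq_univ, mfderivWithin_univ] at h
  exact congrArg (fun A : E →L[ℝ] E => A v) h

lemma chartMetric_self [IsManifold I 1 M]
    (g : ∀ q : M, TangentSpace I q →L[ℝ] TangentSpace I q →L[ℝ] ℝ) (p : M) (v w : E) :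
    chartMetric I g p (extChartAt I p p) v w = g p v w := by
  rw [chartMetric_apply]
  have hv := mfderiv_extChartAt_symm_self (I := I) p v
  have hw := mfderiv_extChartAt_symm_self (I := I) p w
  -- The inverse chart returns `p` only up to a propositional equality and `g` is dependent, so the
  -- base point is generalized before substituting.
  have hg : ∀ q : M, q = p → ∀ a b a' b' : E, a = a' → b = b' →
      (g q : E →L[ℝ] E →L[ℝ] ℝ) a b = (g p : E →L[ℝ] E →L[ℝ] ℝ) a' b' := by
    rintro q rfl a b a' b' rfl rfl
    rfl
  exact hg _ (extChartAt_to_inv p) _ _ _ _ hv hw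

lemma mdifferentiableAt_extChartAt_symm [IsManifold I 1 M] {p : M} {y : E}
    (hy : y ∈ (extChartAt I p).target) :
    MDifferentiableAt 𝓘(ℝ, E) I (extChartAt I p).symm y := by
  have h := mdifferentiableWithinAt_extChartAt_symm hy
  rwa [I.range_eq_univ, mdifferentiableWithinAt_univ] at h

lemma chartMetric_pos [IsManifold I 1 M]
    {g : ∀ q : M, TangentSpace I q →L[ℝ] TangentSpace I q →L[ℝ] ℝ}
    (hg : ∀ (q : M) (v : TangentSpace I q), v ≠ 0 → 0 < g q v v) {p : M} {y : E}
    (hy : y ∈ (extChartAt I p).target) {v : E} (hv : v ≠ 0) : 0 < chartMetric I g p y v v := by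
  rw [chartMetric_apply]
  refine hg _ _ fun h0 => hv ?_
  have hinv := isInvertible_mfderivWithin_extChartAt_symm (I := I) hy
  rw [I.range_eq_univ, mfderivWithin_univ] at hinv
  exact hinv.injective (h0.trans (map_zero _).symm)

/-- In a chart, a smooth Riemannian metric has a smooth Gram form. -/
lemma contDiffAt_chartMetric [IsManifold I ∞ M]
    (g : ContMDiffRiemannianMetric I ∞ E (fun x : M => TangentSpace I x)) (p : M) :
    ContDiffAt ℝ ∞ (chartMetric I g.inner p) (extChartAt I p p) := by
  have hg := g.contMDiff.contMDiffAt (x := p)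
  rw [contMDiffAt_section] at hg
  have hσ : ContMDiffAt 𝓘(ℝ, E) I ∞ (extChartAt I p).symm (extChartAt I p p) :=
    (contMDiffOn_extChartAt_symm p).contMDiffAt (extChartAt_target_mem_nhds p)
  have hcomp := ContMDiffAt.comp_of_eq (x := extChartAt I p p) hg hσ (extChartAt_to_inv p)
  refine hcomp.contDiffAt.congr_of_eventuallyEq ?_
  filter_upwards [extChartAt_target_mem_nhds (I := I) p] with y hy
  have hsrc : (extChartAt I p).symm y ∈ (chartAt H p).source := by
    rw [← extChartAt_source I]
    exact (extChartAt I p).map_target hy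
  -- The fibre inverse of the tangent bundle trivialization is the derivative of the inverse chart,
  -- so the Gram form is `g` read in the trivialization of the bundle of bilinear forms.
  have hsymm : ∀ v, ((trivializationAt E (TangentSpace I) p).symm ((extChartAt I p).symm y) v : E) =
      mfderiv 𝓘(ℝ, E) I (extChartAt I p).symm y v := by
    intro v
    have h := TangentBundle.symmL_trivializationAt (I := I) hsrc
    rw [I.range_eq_univ, mfderivWithin_univ, (extChartAt I p).right_inv hy] at h
    exact (Trivialization.symmL_apply (R := ℝ) (trivializationAt E (TangentSpace I) p) hsrc v).symm.trans
      (congrArg (fun A : E →L[ℝ] E => A v) h)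
  have hid : ∀ (b : M) (r : ℝ),
      (trivializationAt ℝ (Bundle.Trivial M ℝ) p).linearMapAt ℝ b r = r := by simp
  ext v w
  rw [chartMetric_apply, Function.comp_apply, hom_trivializationAt_apply]
  change _ = ContinuousLinearMap.inCoordinates E (TangentSpace I) (E →L[ℝ] ℝ)
    (fun x : M => TangentSpace I x →L[ℝ] ℝ) p ((extChartAt I p).symm y) p ((extChartAt I p).symm y)
    (g.inner ((extChartAt I p).symm y)) v w
  rw [inCoordinates_apply_eq₂ hsrc hsrc (Set.mem_univ _)]
  rw [← hsymm v, ← hsymm w]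
  exact (hid _ _).symm

end ChartMetric

/-! ### The static metric in a product chart. -/

section StandardStatic

variable {s : ℕ} {F : Type*} [TopologicalSpace F] [ChartedSpace (EuclideanSpace ℝ (Fin s)) F]
  {t₁ t₂ : EReal}

lemma coe_extChartAt_openInterval_symm (t : openInterval t₁ t₂) {τ : ℝ}
    (hτ : τ ∈ (extChartAt 𝓘(ℝ, ℝ) t).target) :
    (((extChartAt 𝓘(ℝ, ℝ) t).symm τ : openInterval t₁ t₂) : ℝ) = τ :=
  (extChartAt 𝓘(ℝ, ℝ) t).right_inv hτ

/-- Taking the base point and the components as variables with equations avoids rewriting inside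
dependent tangent spaces. -/
lemma standardStaticMetric_apply_of_eq
    {gF : ∀ x : F, TangentSpace (𝓡 s) x →L[ℝ] TangentSpace (𝓡 s) x →L[ℝ] ℝ} {f : F → ℝ}
    {q : openInterval t₁ t₂ × F} {x : F} (hx : q.2 = x) {U W : ℝ × EuclideanSpace ℝ (Fin s)}
    {a b : ℝ} {u w : EuclideanSpace ℝ (Fin s)}
    (ha : (mfderiv (𝓘(ℝ, ℝ).prod (𝓡 s)) 𝓘(ℝ, ℝ)
      (fun q : openInterval t₁ t₂ × F => (q.1 : ℝ)) q U : ℝ) = a)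
    (hb : (mfderiv (𝓘(ℝ, ℝ).prod (𝓡 s)) 𝓘(ℝ, ℝ)
      (fun q : openInterval t₁ t₂ × F => (q.1 : ℝ)) q W : ℝ) = b)
    (hu : (mfderiv (𝓘(ℝ, ℝ).prod (𝓡 s)) (𝓡 s) (fun q : openInterval t₁ t₂ × F => q.2) q U :
      EuclideanSpace ℝ (Fin s)) = u)
    (hw : (mfderiv (𝓘(ℝ, ℝ).prod (𝓡 s)) (𝓡 s) (fun q : openInterval t₁ t₂ × F => q.2) q W :
      EuclideanSpace ℝ (Fin s)) = w) :
    standardStaticMetric t₁ t₂ gF f q U W = gF x u w - f x ^ 2 * (a * b) := by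
  subst hx ha hb hu hw
  rfl

/-- The chart of `openInterval` is the inclusion into `ℝ`, so in the product chart `dt` and the
differential of the projection to `F` become the two coordinate projections, by the chain rule. -/
lemma chartMetric_standardStaticMetric [IsManifold (𝓡 s) 1 F]
    (gF : ∀ x : F, TangentSpace (𝓡 s) x →L[ℝ] TangentSpace (𝓡 s) x →L[ℝ] ℝ) (f : F → ℝ)
    (p : openInterval t₁ t₂ × F) :
    chartMetric (𝓘(ℝ, ℝ).prod (𝓡 s)) (standardStaticMetric t₁ t₂ gF f) p
      =ᶠ[𝓝 (extChartAt (𝓘(ℝ, ℝ).prod (𝓡 s)) p p)]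
    staticGram (chartMetric (𝓡 s) gF p.2) (f ∘ (extChartAt (𝓡 s) p.2).symm) := by
  have htarget := extChartAt_target_mem_nhds (I := 𝓘(ℝ, ℝ).prod (𝓡 s)) p
  -- Differentiating at `y` requires the chart target to be a neighbourhood of `y`, not merely to
  -- contain it.
  filter_upwards [htarget, eventually_mem_nhds_iff.2 htarget] with y hy hy'
  set σ : ℝ × EuclideanSpace ℝ (Fin s) → openInterval t₁ t₂ × F :=
    ⇑(extChartAt (𝓘(ℝ, ℝ).prod (𝓡 s)) p).symm with hσ
  have hσd : MDifferentiableAt 𝓘(ℝ, ℝ × EuclideanSpace ℝ (Fin s)) (𝓘(ℝ, ℝ).prod (𝓡 s)) σ y :=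
    mdifferentiableAt_extChartAt_symm hy
  have hy2 : y.2 ∈ (extChartAt (𝓡 s) p.2).target := by
    rw [extChartAt_prod] at hy
    exact hy.2
  have hdσ : ∀ X, (mfderiv (𝓘(ℝ, ℝ).prod (𝓡 s)) (𝓡 s) (fun q : openInterval t₁ t₂ × F => q.2) (σ y)
      (mfderiv 𝓘(ℝ, ℝ × EuclideanSpace ℝ (Fin s)) (𝓘(ℝ, ℝ).prod (𝓡 s)) σ y X) :
        EuclideanSpace ℝ (Fin s)) =
      mfderiv 𝓘(ℝ, EuclideanSpace ℝ (Fin s)) (𝓡 s) (extChartAt (𝓡 s) p.2).symm y.2 X.2 := by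
    intro X
    have h1 := mfderiv_comp_apply y (mdifferentiableAt_snd (I := 𝓘(ℝ, ℝ)) (I' := 𝓡 s)) hσd X
    have hsnd : HasMFDerivAt 𝓘(ℝ, ℝ × EuclideanSpace ℝ (Fin s)) 𝓘(ℝ, EuclideanSpace ℝ (Fin s))
        (Prod.snd : ℝ × EuclideanSpace ℝ (Fin s) → EuclideanSpace ℝ (Fin s)) y
        (ContinuousLinearMap.snd ℝ ℝ (EuclideanSpace ℝ (Fin s))) :=
      hasFDerivAt_snd.hasMFDerivAt
    have h2 := HasMFDerivAt.comp y
      (mdifferentiableAt_extChartAt_symm (I := 𝓡 s) hy2).hasMFDerivAt hsnd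
    exact h1.symm.trans (congrArg (fun A : ℝ × EuclideanSpace ℝ (Fin s) →L[ℝ]
      EuclideanSpace ℝ (Fin s) => A X) h2.mfderiv)
  have hdt : ∀ X, (mfderiv (𝓘(ℝ, ℝ).prod (𝓡 s)) 𝓘(ℝ, ℝ)
      (fun q : openInterval t₁ t₂ × F => (q.1 : ℝ)) (σ y)
      (mfderiv 𝓘(ℝ, ℝ × EuclideanSpace ℝ (Fin s)) (𝓘(ℝ, ℝ).prod (𝓡 s)) σ y X) : ℝ) = X.1 := by
    intro X
    have hcoord : MDifferentiableAt (𝓘(ℝ, ℝ).prod (𝓡 s)) 𝓘(ℝ, ℝ)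
        (fun q : openInterval t₁ t₂ × F => (q.1 : ℝ)) (σ y) :=
      ((contMDiff_subtype_val (n := 1)).mdifferentiable (by simp) (σ y).1).comp (σ y)
        mdifferentiableAt_fst
    have h1 := mfderiv_comp_apply y hcoord hσd X
    have hfst : HasMFDerivAt 𝓘(ℝ, ℝ × EuclideanSpace ℝ (Fin s)) 𝓘(ℝ, ℝ)
        (Prod.fst : ℝ × EuclideanSpace ℝ (Fin s) → ℝ) y
        (ContinuousLinearMap.fst ℝ ℝ (EuclideanSpace ℝ (Fin s))) :=
      hasFDerivAt_fst.hasMFDerivAt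
    have hev : (fun q : openInterval t₁ t₂ × F => (q.1 : ℝ)) ∘ σ =ᶠ[𝓝 y] Prod.fst := by
      filter_upwards [hy'] with z hz
      rw [extChartAt_prod] at hz
      have := coe_extChartAt_openInterval_symm p.1 hz.1
      rw [Function.comp_apply, hσ, extChartAt_prod]
      exact this
    exact h1.symm.trans (congrArg (fun A : ℝ × EuclideanSpace ℝ (Fin s) →L[ℝ] ℝ => A X)
      (hfst.congr_of_eventuallyEq hev).mfderiv)
  refine ContinuousLinearMap.ext fun X => ContinuousLinearMap.ext fun Y => ?_
  have hsndσ : (σ y).2 = (extChartAt (𝓡 s) p.2).symm y.2 := by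
    rw [hσ, extChartAt_prod]
    rfl
  rw [staticGram_apply, chartMetric_apply, chartMetric_apply]
  exact standardStaticMetric_apply_of_eq hsndσ (hdt X) (hdt Y) (hdσ X) (hdσ Y)

end StandardStatic

/-! ### Ricci curvature of the space-time and the sign of the Laplacian. -/

section RicciStandardStatic

variable {s : ℕ} {F : Type*} [TopologicalSpace F] [ChartedSpace (EuclideanSpace ℝ (Fin s)) F]
  {t₁ t₂ : EReal}

lemma standardStaticMetric_apply [IsManifold (𝓡 s) 1 F]
    (gF : ∀ x : F, TangentSpace (𝓡 s) x →L[ℝ] TangentSpace (𝓡 s) x →L[ℝ] ℝ) (f : F → ℝ)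
    (p : openInterval t₁ t₂ × F) (v w : ℝ × EuclideanSpace ℝ (Fin s)) :
    standardStaticMetric t₁ t₂ gF f p v w = gF p.2 v.2 w.2 - f p.2 ^ 2 * (v.1 * w.1) := by
  have h := (chartMetric_standardStaticMetric gF f p).self_of_nhds
  have h1 := chartMetric_self (I := 𝓘(ℝ, ℝ).prod (𝓡 s)) (standardStaticMetric t₁ t₂ gF f) p v w
  have hy : (extChartAt (𝓘(ℝ, ℝ).prod (𝓡 s)) p p).2 = extChartAt (𝓡 s) p.2 p.2 := by
    rw [extChartAt_prod]
    rfl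
  rw [h, staticGram_apply, hy, chartMetric_self, Function.comp_apply, extChartAt_to_inv] at h1
  exact h1.symm

variable [IsManifold (𝓡 s) ∞ F]

lemma chartMetric_symm (gF : Bundle.ContMDiffRiemannianMetric (𝓡 s) ∞
      (EuclideanSpace ℝ (Fin s)) (fun x : F => TangentSpace (𝓡 s) x)) (x : F)
    (y v w : EuclideanSpace ℝ (Fin s)) :
    chartMetric (𝓡 s) gF.inner x y v w = chartMetric (𝓡 s) gF.inner x y w v :=
  gF.symm _ _ _

/-- The Ricci curvature of a standard static space-time. -/
lemma ricciTensor_standardStaticMetric (gF : Bundle.ContMDiffRiemannianMetric (𝓡 s) ∞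
      (EuclideanSpace ℝ (Fin s)) (fun x : F => TangentSpace (𝓡 s) x))
    {f : F → ℝ} (hf : ContMDiff (𝓡 s) 𝓘(ℝ, ℝ) ∞ f) (hf_pos : ∀ x, 0 < f x)
    (p : openInterval t₁ t₂ × F) (w : ℝ × EuclideanSpace ℝ (Fin s)) :
    ricciTensor (𝓘(ℝ, ℝ).prod (𝓡 s)) (standardStaticMetric t₁ t₂ gF.inner f) p w w =
      ricciTensor (𝓡 s) gF.inner p.2 w.2 w.2
        - (f p.2)⁻¹ * hessianTensor (𝓡 s) gF.inner f p.2 w.2 w.2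
        + w.1 ^ 2 * f p.2 * laplaceBeltrami (𝓡 s) gF.inner f p.2 := by
  have hy : (extChartAt (𝓘(ℝ, ℝ).prod (𝓡 s)) p p).2 = extChartAt (𝓡 s) p.2 p.2 := by
    rw [extChartAt_prod]
    rfl
  have hfp : (f ∘ (extChartAt (𝓡 s) p.2).symm) (extChartAt (𝓡 s) p.2 p.2) = f p.2 := by
    rw [Function.comp_apply, extChartAt_to_inv]
  have hfc : ContDiffAt ℝ 2 (f ∘ (extChartAt (𝓡 s) p.2).symm) (extChartAt (𝓡 s) p.2 p.2) := by
    have hσ : ContMDiffAt 𝓘(ℝ, EuclideanSpace ℝ (Fin s)) (𝓡 s) ∞ (extChartAt (𝓡 s) p.2).symm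
        (extChartAt (𝓡 s) p.2 p.2) :=
      (contMDiffOn_extChartAt_symm p.2).contMDiffAt (extChartAt_target_mem_nhds p.2)
    exact (hf.contMDiffAt.comp _ hσ).contDiffAt.of_le (WithTop.coe_le_coe.2 (le_top : (2 : ℕ∞) ≤ ⊤))
  have hpos : ∀ᶠ z in 𝓝 (extChartAt (𝓡 s) p.2 p.2), ∀ v, v ≠ 0 →
      0 < chartMetric (𝓡 s) gF.inner p.2 z v v := by
    filter_upwards [extChartAt_target_mem_nhds (I := 𝓡 s) p.2] with z hz v hv
    exact chartMetric_pos gF.pos hz hv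
  have hG : ContDiffAt ℝ 2 (chartMetric (𝓡 s) gF.inner p.2) (extChartAt (𝓡 s) p.2 p.2) :=
    (contDiffAt_chartMetric gF p.2).of_le (WithTop.coe_le_coe.2 (le_top : (2 : ℕ∞) ≤ ⊤))
  unfold ricciTensor
  rw [(chartMetric_standardStaticMetric gF.inner f p).localRicci_eq]
  have key := localRicci_staticGram (y := extChartAt (𝓘(ℝ, ℝ).prod (𝓡 s)) p p)
    (G := chartMetric (𝓡 s) gF.inner p.2) (h := f ∘ (extChartAt (𝓡 s) p.2).symm)
    (by rwa [hy]) (by rwa [hy])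
    (Filter.Eventually.of_forall fun z => chartMetric_symm gF p.2 z)
    (by rwa [hy]) (by rw [hy, hfp]; exact (hf_pos _).ne') w
  rw [hy, hfp] at key
  exact key

/-- The metric trace of `Q` is `(s - 1) Δf`, and `s - 1 > 0`. The factor `c` lets one argument serve
both signs, through `c = 1` and `c = -1`. -/
lemma laplaceBeltrami_nonneg (hs : 2 ≤ s) (gF : Bundle.ContMDiffRiemannianMetric (𝓡 s) ∞
      (EuclideanSpace ℝ (Fin s)) (fun x : F => TangentSpace (𝓡 s) x)) (f : F → ℝ) (c : ℝ) (x : F)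
    (hQ : ∀ v : TangentSpace (𝓡 s) x, 0 ≤ c * qTensor (𝓡 s) gF.inner f x v v) :
    0 ≤ c * laplaceBeltrami (𝓡 s) gF.inner f x := by
  let G : EuclideanSpace ℝ (Fin s) →L[ℝ] EuclideanSpace ℝ (Fin s) →L[ℝ] ℝ :=
    chartMetric (𝓡 s) gF.inner x (extChartAt (𝓡 s) x x)
  let B := localHessian (chartMetric (𝓡 s) gF.inner x) (f ∘ (extChartAt (𝓡 s) x).symm)
    (extChartAt (𝓡 s) x x)
  have hpos : ∀ v, v ≠ 0 → 0 < G v v := fun v hv =>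
    chartMetric_pos gF.pos (mem_extChartAt_target x) hv
  have htr := trace_inverse_comp_nonneg (G := G)
    (B := c • (laplaceBeltrami (𝓡 s) gF.inner f x • G - B))
    (chartMetric_symm gF x _) hpos (fun v => by
      have h1 : G v v = gF.inner x v v := chartMetric_self gF.inner x v v
      change 0 ≤ c * (laplaceBeltrami (𝓡 s) gF.inner f x * G v v - B v v)
      rw [h1]
      exact hQ v)
  -- Raising an index turns `G` into the identity, of trace `s`, and `B` into an endomorphism of
  -- trace `Δf`.
  have hcomp : ((G.inverse ∘L (c • (laplaceBeltrami (𝓡 s) gF.inner f x • G - B)) :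
        EuclideanSpace ℝ (Fin s) →L[ℝ] EuclideanSpace ℝ (Fin s)) :
        EuclideanSpace ℝ (Fin s) →ₗ[ℝ] EuclideanSpace ℝ (Fin s)) =
      c • (laplaceBeltrami (𝓡 s) gF.inner f x • LinearMap.id -
        ((G.inverse ∘L B : EuclideanSpace ℝ (Fin s) →L[ℝ] EuclideanSpace ℝ (Fin s)) :
          EuclideanSpace ℝ (Fin s) →ₗ[ℝ] EuclideanSpace ℝ (Fin s))) := by
    refine LinearMap.ext fun v => ?_
    simp [(isInvertible_of_pos hpos).inverse_apply_self]
  have hB : LinearMap.trace ℝ (EuclideanSpace ℝ (Fin s))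
      ((G.inverse ∘L B : EuclideanSpace ℝ (Fin s) →L[ℝ] EuclideanSpace ℝ (Fin s)) :
        EuclideanSpace ℝ (Fin s) →ₗ[ℝ] EuclideanSpace ℝ (Fin s)) =
      laplaceBeltrami (𝓡 s) gF.inner f x := rfl
  rw [hcomp, map_smul, map_sub, map_smul, LinearMap.trace_id, hB, finrank_euclideanSpace_fin,
    smul_eq_mul, smul_eq_mul] at htr
  have hs' : (0 : ℝ) < s - 1 := by
    have : (2 : ℝ) ≤ s := by exact_mod_cast hs
    linarith
  have : 0 ≤ (c * laplaceBeltrami (𝓡 s) gF.inner f x) * ((s : ℝ) - 1) := by linarith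
  exact nonneg_of_mul_nonneg_left this hs'

/-- The Ricci curvature of a standard static space-time in terms of `Ric_F`, `Q` and the
Laplacian, whose coefficient has the sign of `-g(w, w)`. -/
lemma ricciTensor_standardStaticMetric_eq (gF : Bundle.ContMDiffRiemannianMetric (𝓡 s) ∞
      (EuclideanSpace ℝ (Fin s)) (fun x : F => TangentSpace (𝓡 s) x))
    {f : F → ℝ} (hf : ContMDiff (𝓡 s) 𝓘(ℝ, ℝ) ∞ f) (hf_pos : ∀ x, 0 < f x)
    (p : openInterval t₁ t₂ × F) (w : ℝ × EuclideanSpace ℝ (Fin s)) :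
    ricciTensor (𝓘(ℝ, ℝ).prod (𝓡 s)) (standardStaticMetric t₁ t₂ gF.inner f) p w w =
      ricciTensor (𝓡 s) gF.inner p.2 w.2 w.2
        + (f p.2)⁻¹ * qTensor (𝓡 s) gF.inner f p.2 w.2 w.2
        + (f p.2)⁻¹ * (-standardStaticMetric t₁ t₂ gF.inner f p w w)
          * laplaceBeltrami (𝓡 s) gF.inner f p.2 := by
  have hne := (hf_pos p.2).ne'
  have h1 := standardStaticMetric_apply (t₁ := t₁) (t₂ := t₂) gF.inner f p w w
  rw [ricciTensor_standardStaticMetric gF hf hf_pos]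
  unfold qTensor
  erw [h1]
  field_simp
  ring

end RicciStandardStatic

/-! ### The convergence conditions. -/

theorem theorem4p1 {s : ℕ} (hs : 2 ≤ s) {F : Type*} [TopologicalSpace F]
    [ChartedSpace (EuclideanSpace ℝ (Fin s)) F] [IsManifold (𝓡 s) ∞ F]
    (gF : Bundle.ContMDiffRiemannianMetric (𝓡 s) ∞ (EuclideanSpace ℝ (Fin s))
      (fun x : F => TangentSpace (𝓡 s) x))
    (f : F → ℝ) (hf : ContMDiff (𝓡 s) 𝓘(ℝ, ℝ) ∞ f) (hf_pos : ∀ x, 0 < f x)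
    (t₁ t₂ : EReal) (ht : t₁ < t₂) :
    -- Part 1
    (TensorPosSemidef (𝓡 s) (ricciTensor (𝓡 s) gF.inner) →
      TensorPosSemidef (𝓡 s) (qTensor (𝓡 s) gF.inner f) →
      SatisfiesTCC (𝓘(ℝ, ℝ).prod (𝓡 s)) (standardStaticMetric t₁ t₂ gF.inner f) ∧
        SatisfiesNCC (𝓘(ℝ, ℝ).prod (𝓡 s)) (standardStaticMetric t₁ t₂ gF.inner f)) ∧
    -- Part 2
    (TensorNegSemidef (𝓡 s) (ricciTensor (𝓡 s) gF.inner) →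
      TensorNegSemidef (𝓡 s) (qTensor (𝓡 s) gF.inner f) →
      ∀ (p : openInterval t₁ t₂ × F) (w : TangentSpace (𝓘(ℝ, ℝ).prod (𝓡 s)) p),
        IsCausal (standardStaticMetric t₁ t₂ gF.inner f) w →
        ricciTensor (𝓘(ℝ, ℝ).prod (𝓡 s)) (standardStaticMetric t₁ t₂ gF.inner f) p w w ≤ 0) ∧
    -- Part 3
    (RicciFlat (𝓡 s) gF.inner →
      (TensorPosSemidef (𝓡 s) (qTensor (𝓡 s) gF.inner f) ↔
        SatisfiesNCC (𝓘(ℝ, ℝ).prod (𝓡 s)) (standardStaticMetric t₁ t₂ gF.inner f))) := by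
  have hric := fun (p : openInterval t₁ t₂ × F) (w : ℝ × EuclideanSpace ℝ (Fin s)) =>
    ricciTensor_standardStaticMetric_eq gF hf hf_pos p w
  have hfinv : ∀ x, 0 ≤ (f x)⁻¹ := fun x => (inv_pos.2 (hf_pos x)).le
  have hcausal : ∀ (p : openInterval t₁ t₂ × F) (w : TangentSpace (𝓘(ℝ, ℝ).prod (𝓡 s)) p),
      IsCausal (standardStaticMetric t₁ t₂ gF.inner f) w →
      0 ≤ -standardStaticMetric t₁ t₂ gF.inner f p w w := by
    rintro p w (h | h)
    · exact neg_nonneg.2 (le_of_lt h)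
    · exact (neg_nonneg.2 h.2.le)
  have hnonneg : TensorPosSemidef (𝓡 s) (ricciTensor (𝓡 s) gF.inner) →
      TensorPosSemidef (𝓡 s) (qTensor (𝓡 s) gF.inner f) →
      ∀ (p : openInterval t₁ t₂ × F) (w : TangentSpace (𝓘(ℝ, ℝ).prod (𝓡 s)) p),
        IsCausal (standardStaticMetric t₁ t₂ gF.inner f) w →
        0 ≤ ricciTensor (𝓘(ℝ, ℝ).prod (𝓡 s)) (standardStaticMetric t₁ t₂ gF.inner f) p w w := by
    intro hR hQ p w hw
    refine le_of_le_of_eq ?_ (hric p w).symm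
    have hΔ := laplaceBeltrami_nonneg hs gF f 1 p.2 fun v => by simpa using hQ p.2 v
    rw [one_mul] at hΔ
    exact add_nonneg (add_nonneg (hR p.2 _) (mul_nonneg (hfinv _) (hQ p.2 _)))
      (mul_nonneg (mul_nonneg (hfinv _) (hcausal p w hw)) hΔ)
  refine ⟨fun hR hQ => ⟨fun p w hw => hnonneg hR hQ p w (Or.inl hw),
    fun p w hw => hnonneg hR hQ p w (Or.inr hw)⟩, fun hR hQ p w hw => ?_, fun hflat =>
    ⟨fun hQ p w hw => hnonneg (fun x v => (hflat x v v).ge) hQ p w (Or.inr hw), fun hN x v => ?_⟩⟩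
  · refine le_of_eq_of_le (hric p w) ?_
    have hΔ := laplaceBeltrami_nonneg hs gF f (-1) p.2 fun v => by simpa using hQ p.2 v
    rw [neg_one_mul, neg_nonneg] at hΔ
    exact add_nonpos (add_nonpos (hR p.2 _) (mul_nonpos_of_nonneg_of_nonpos (hfinv _) (hQ p.2 _)))
      (mul_nonpos_of_nonneg_of_nonpos (mul_nonneg (hfinv _) (hcausal p w hw)) hΔ)
  · obtain ⟨t, ht₁, ht₂⟩ := EReal.lt_iff_exists_real_btwn.1 ht
    -- Null vectors are nonzero by convention, so `v = 0` has no null lift and is settled directly.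
    by_cases hv : v = 0
    · subst hv
      have hH : hessianTensor (𝓡 s) gF.inner f x 0 0 = 0 := map_zero _
      simp [qTensor, hH]
    have hvpos := gF.pos x v hv
    have hfx := hf_pos x
    let p : openInterval t₁ t₂ × F := (⟨t, ht₁, ht₂⟩, x)
    -- The time component solves `f² τ² = g_F(v, v)`, which makes `w` null.
    let w : ℝ × EuclideanSpace ℝ (Fin s) := (Real.sqrt (gF.inner x v v) / f x, v)
    have hnull : standardStaticMetric t₁ t₂ gF.inner f p w w = 0 := by
      refine (standardStaticMetric_apply gF.inner f p w w).trans ?_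
      have hsq := Real.mul_self_sqrt hvpos.le
      change gF.inner x v v - f x ^ 2 * (Real.sqrt (gF.inner x v v) / f x *
        (Real.sqrt (gF.inner x v v) / f x)) = 0
      field_simp
      linarith
    have hw : w ≠ 0 := fun h0 => hv (congrArg Prod.snd h0)
    have hRic := hN p w ⟨hw, hnull⟩
    rw [hric p w, hnull, hflat] at hRic
    rw [neg_zero, mul_zero, zero_mul, add_zero, zero_add] at hRic
    exact nonneg_of_mul_nonneg_right hRic (inv_pos.2 hfx)
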